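/- Let $n\ge 0$, let $K\subseteq\mathbb{R}^n$ be a nonempty closed convex set (not necessarily bounded) and let $\sigma>0$. For $\mu\in K$ observe $Y=\mu+\xi$ with $\xi\sim N(0,\sigma^2\mathbb{I}_n)$, and let $\hat\mu=\hat\mu(Y)=\operatorname{argmin}_{\nu\in K}\|Y-\nu\|^2$ be the least squares estimator, where $\|\cdot\|$ is the Euclidean norm. Define $\varepsilon_K\ge 0$ by $\varepsilon_K^2=\sup_{\mu\in K}\mathbb{E}\|\hat\mu-\mu\|^2$, and let $d=\operatorname{diam}(K)=\sup\{\|\theta-\theta'\|:\theta,\theta'\in K\}\in[0,\infty]$. For $\mu\in K$ and $\varepsilon\ge 0$ let $$w_\mu(\varepsilon)=\mathbb{E}\sup_{t\in K,\ \|t-\mu\|\le\varepsilon}\langle x,t\rangle,\qquad x\sim N(0,\mathbb{I}_n),$$ be the local Gaussian width, and put $$\overline\varepsilon=\sup\Big\{\varepsilon\ge 0:\ \frac{\varepsilon^2}{2\sigma}\le\sup_{\mu\in K}w_\mu(\varepsilon)\Big\}.$$ Then there is an absolute constant $C>0$ (not depending on $n$, $K$ or $\sigma$) such that $$\varepsilon_K\le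 C\,\min(\overline\varepsilon,d).$$ -/

import Mathlib

open MeasureTheory ProbabilityTheory
open scoped ENNReal NNReal

namespace GaussianSeq

/-- The Gaussian width `w(T) = 𝔼 sup_{t ∈ T} ⟨x, t⟩`, `x ∼ N(0, Iₙ)`, of a set `T ⊆ ℝⁿ`.
It is only used for nonempty bounded sets `T`, for which the supremum is finite
for every `x` and integrable. -/
noncomputable def gaussianWidth {n : ℕ} (T : Set (EuclideanSpace ℝ (Fin n))) : ℝ :=
  ∫ x, (⨆ t : T, inner ℝ x (t : EuclideanSpace ℝ (Fin n)))
    ∂(stdGaussian (EuclideanSpace ℝ (Fin n)))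

/-- The local Gaussian width `w_{K,μ}(ε) = w(B(μ, ε) ∩ K)`, with `B(μ, ε)` the closed ball. -/
noncomputable def localWidth {n : ℕ} (K : Set (EuclideanSpace ℝ (Fin n)))
    (μ : EuclideanSpace ℝ (Fin n)) (ε : ℝ) : ℝ :=
  gaussianWidth (Metric.closedBall μ ε ∩ K)

/-- `p` is a point of `K` that minimizes `ν ↦ ‖y - ν‖²` over `ν ∈ K`. -/
def IsLeastSquares {n : ℕ} (K : Set (EuclideanSpace ℝ (Fin n)))
    (y p : EuclideanSpace ℝ (Fin n)) : Prop :=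
  p ∈ K ∧ ∀ ν ∈ K, ‖y - p‖ ^ 2 ≤ ‖y - ν‖ ^ 2

open Classical in
/-- The least squares estimator `argmin_{ν ∈ K} ‖y - ν‖²` on the data `y` (junk value `0` if there
is no minimizer; for closed convex nonempty `K` there is exactly one, see below). -/
noncomputable def lse {n : ℕ} (K : Set (EuclideanSpace ℝ (Fin n)))
    (y : EuclideanSpace ℝ (Fin n)) : EuclideanSpace ℝ (Fin n) :=
  if h : ∃ p, IsLeastSquares K y p then h.choose else 0

/-- On a closed nonempty set the least squares estimator is a minimizer. -/
theorem isLeastSquares_lse {n : ℕ} {K : Set (EuclideanSpace ℝ (Fin n))} (hcl : IsClosed K)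
    (hne : K.Nonempty) (y : EuclideanSpace ℝ (Fin n)) : IsLeastSquares K y (lse K y) := by
  have h : ∃ p, IsLeastSquares K y p := by
    obtain ⟨p, hp, hd⟩ := hcl.exists_infDist_eq_dist hne y
    refine ⟨p, hp, fun ν hν => ?_⟩
    have h1 : ‖y - p‖ ≤ ‖y - ν‖ := by
      rw [← dist_eq_norm, ← dist_eq_norm, ← hd]
      exact Metric.infDist_le_dist_of_mem hν
    gcongr
  unfold lse
  rw [dif_pos h]
  exact h.choose_spec

/-- On a convex set there is at most one minimizer. -/
theorem IsLeastSquares.unique {n : ℕ} {K : Set (EuclideanSpace ℝ (Fin n))} (hK : Convex ℝ K)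
    {y p q : EuclideanSpace ℝ (Fin n)} (hp : IsLeastSquares K y p) (hq : IsLeastSquares K y q) :
    p = q := by
  have hm : (1 / 2 : ℝ) • p + (1 / 2 : ℝ) • q ∈ K :=
    hK hp.1 hq.1 (by norm_num) (by norm_num) (by norm_num)
  have h1 := hp.2 _ hm
  have h2 := hq.2 _ hp.1
  have h3 := parallelogram_law_with_norm ℝ (y - p) (y - q)
  have e1 : y - p + (y - q) = (2 : ℝ) • (y - ((1 / 2 : ℝ) • p + (1 / 2 : ℝ) • q)) := by
    module
  have e2 : y - p - (y - q) = q - p := by abel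
  rw [e1, e2, norm_smul] at h3
  norm_num at h3 h1
  have h4 : ‖q - p‖ = 0 := by nlinarith [norm_nonneg (q - p)]
  exact (sub_eq_zero.mp (norm_eq_zero.mp h4)).symm

/-- The risk `𝔼 ‖μ̂(Y) - μ‖²` of the least squares estimator at `μ`, where `Y = μ + ξ` and
`ξ = σ x ∼ N(0, σ² Iₙ)` with `x ∼ N(0, Iₙ)`. -/
noncomputable def lseRisk {n : ℕ} (K : Set (EuclideanSpace ℝ (Fin n))) (σ : ℝ)
    (μ : EuclideanSpace ℝ (Fin n)) : ℝ≥0∞ :=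
  ∫⁻ x, ENNReal.ofReal (‖lse K (μ + σ • x) - μ‖ ^ 2) ∂(stdGaussian (EuclideanSpace ℝ (Fin n)))

/-- The worst case rate `ε_K(σ)`, where `ε_K(σ)² = sup_{μ ∈ K} 𝔼 ‖μ̂ - μ‖²`. -/
noncomputable def worstCaseRate {n : ℕ} (K : Set (EuclideanSpace ℝ (Fin n))) (σ : ℝ) : ℝ≥0∞ :=
  (⨆ μ ∈ K, lseRisk K σ μ) ^ (1 / 2 : ℝ)

/-- `ε̄ = sup {ε ≥ 0 : ε² / (2σ) ≤ sup_{μ ∈ K} w_μ(ε)}`. For `K` nonempty and `σ > 0` both suprema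
are over nonempty bounded sets of reals, since `0 ≤ w_μ(ε) ≤ ε √n` for `μ ∈ K`. -/
noncomputable def epsBar {n : ℕ} (K : Set (EuclideanSpace ℝ (Fin n))) (σ : ℝ) : ℝ :=
  sSup {ε : ℝ | 0 ≤ ε ∧ ε ^ 2 / (2 * σ) ≤ ⨆ μ : K, localWidth K (μ : EuclideanSpace ℝ (Fin n)) ε}

end GaussianSeq

/-! Fix `ε > epsBar K σ` and `μ ∈ K`, and write `p` for the estimator and `r = ‖p - μ‖`. The basic
inequality gives `r ^ 2 ≤ σ⟨x, p - μ⟩`. If `r > ε`, convexity lets `p` be shrunk towards `μ` onto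
the sphere of radius `ε`, whence `r ≤ (σ / ε) g(x)` with `g` the width of `closedBall μ ε ∩ K` in
direction `x` (`norm_lse_sub_sq_le`). It remains to bound the second moment of `g`, whose mean is
twice the local Gaussian width. Concentration is not needed: `g` is a continuous seminorm, and
rotation invariance of a pair of independent centered Gaussians yields `𝔼 g² ≤ 2 (𝔼 g)²`
(`integral_seminorm_sq_le`). Since the local width is below `ε ^ 2 / (2 * σ)`, the risk is at most
`3 * ε ^ 2`; then `ε` decreases to `epsBar K σ`. The diameter bound is immediate, as `p` and `μ`
both lie in `K`. -/

namespace GaussianSeq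

/-! ### Moments of seminorms of Gaussian vectors. -/

section GaussianSeminorm

/-- Subadditivity along the orthogonal pair `c • (x - y)`, `c • (x + y)` with `2 * c ^ 2 = 1`. -/
theorem sq_add_sq_le_of_seminorm {F : Type*} [AddCommGroup F] [Module ℝ F] (p : Seminorm ℝ F)
    {c : ℝ} (hc : 2 * c ^ 2 = 1) (x y : F) :
    p x ^ 2 + p y ^ 2 ≤ 2 * (p x * p y) + 2 * (p (c • (x - y)) * p (c • (x + y))) := by
  have h1 : |p x - p y| ≤ p (x - y) := abs_sub_map_le_sub p x y
  have h2 : |p x - p y| ≤ p (x + y) := by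
    have := abs_sub_map_le_sub p x (-y)
    rwa [map_neg_eq_map, sub_neg_eq_add] at this
  -- The two bounds on the same quantity are multiplied, so that the right side is a product over
  -- the rotated pair.
  have h3 : (p x - p y) ^ 2 ≤ p (x - y) * p (x + y) := by
    rw [← sq_abs, sq]
    exact mul_le_mul h1 h2 (abs_nonneg _) (apply_nonneg _ _)
  have h4 : 2 * (p (c • (x - y)) * p (c • (x + y))) = p (x - y) * p (x + y) := by
    rw [map_smul_eq_mul, map_smul_eq_mul, Real.norm_eq_abs]
    have : |c| * |c| = c ^ 2 := by rw [← sq, sq_abs]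
    linear_combination 2 * p (x - y) * p (x + y) * this + p (x - y) * p (x + y) * hc
  rw [h4]
  linarith [h3]

variable {E : Type*} [NormedAddCommGroup E] [NormedSpace ℝ E] [CompleteSpace E]
  [SecondCountableTopology E] [MeasurableSpace E] [BorelSpace E]

theorem memLp_two_seminorm {ν : Measure E} [IsGaussian ν] {p : Seminorm ℝ E}
    (hp : Continuous p) : MemLp p 2 ν := by
  obtain ⟨C, -, hC⟩ := Seminorm.bound_of_continuous_normedSpace p hp
  refine MemLp.of_le_mul (c := C) (IsGaussian.memLp_two_id (μ := ν)) hp.aestronglyMeasurable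
    (ae_of_all _ fun x => ?_)
  simpa [abs_of_nonneg (apply_nonneg p x)] using hC x

/-- The second moment of a seminorm of a centered Gaussian vector is at most twice the square of
its first moment. -/
theorem integral_seminorm_sq_le {ν : Measure E} [IsGaussian ν] (hν : ν[id] = 0)
    {p : Seminorm ℝ E} (hp : Continuous p) :
    ∫ x, p x ^ 2 ∂ν ≤ 2 * (∫ x, p x ∂ν) ^ 2 := by
  have hL2 : MemLp p 2 ν := memLp_two_seminorm hp
  have hi : Integrable p ν := hL2.integrable (by norm_num)
  have hi2 : Integrable (fun x => p x ^ 2) ν := hL2.integrable_sq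
  have hprod : Integrable (fun z : E × E => p z.1 * p z.2) (ν.prod ν) := hi.mul_prod hi
  -- Rotating by this angle sends `(x, y)` to `(c • (x - y), c • (x + y))` with `c = 1 / √2`, so
  -- this pair is again independent with law `ν`, and the mean of its product is `(∫ p) ^ 2`.
  have hrot := IsGaussian.map_rotation_eq_self (μ := ν) hν (-(Real.pi / 4))
  have hmeas : Measurable (ContinuousLinearMap.rotation (E := E) (-(Real.pi / 4))) := by
    fun_prop
  set c : ℝ := Real.cos (Real.pi / 4) with hcdef
  have hc : 2 * c ^ 2 = 1 := by
    rw [hcdef, Real.cos_pi_div_four, div_pow, Real.sq_sqrt (by norm_num)]; norm_num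
  have hrot_apply (z : E × E) : ContinuousLinearMap.rotation (-(Real.pi / 4)) z
      = (c • (z.1 - z.2), c • (z.1 + z.2)) := by
    rw [ContinuousLinearMap.rotation_apply, Real.cos_neg, Real.sin_neg,
      show Real.sin (Real.pi / 4) = c by
        rw [hcdef, Real.cos_pi_div_four, Real.sin_pi_div_four]]
    ext <;> simp only [neg_neg] <;> module
  have hprod_rot : Integrable
      (fun z : E × E => p (c • (z.1 - z.2)) * p (c • (z.1 + z.2))) (ν.prod ν) := by
    have h := hprod
    rw [← hrot] at h
    simpa [Function.comp_def, hrot_apply] using h.comp_measurable hmeas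
  have hint_rot : ∫ z : E × E, p (c • (z.1 - z.2)) * p (c • (z.1 + z.2)) ∂(ν.prod ν)
      = (∫ x, p x ∂ν) ^ 2 := by
    rw [sq, ← integral_prod_mul]
    conv_rhs => rw [← hrot]
    rw [integral_map hmeas.aemeasurable (by fun_prop)]
    simp_rw [hrot_apply]
  have hfst : Integrable (fun z : E × E => p z.1 ^ 2) (ν.prod ν) := hi2.comp_fst ν
  have hsnd : Integrable (fun z : E × E => p z.2 ^ 2) (ν.prod ν) := hi2.comp_snd ν
  have key := integral_mono (hfst.add hsnd) ((hprod.const_mul 2).add (hprod_rot.const_mul 2))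
    (fun z => sq_add_sq_le_of_seminorm p hc z.1 z.2)
  simp only [Pi.add_apply] at key
  rw [integral_add hfst hsnd, integral_add (hprod.const_mul 2) (hprod_rot.const_mul 2),
    integral_const_mul, integral_const_mul, hint_rot, integral_prod_mul,
    integral_fun_fst (fun x => p x ^ 2), integral_fun_snd (fun x => p x ^ 2)] at key
  simp only [probReal_univ, one_smul] at key
  linarith [key, sq (∫ x, p x ∂ν)]

end GaussianSeminorm

/-! ### Support functions and their symmetrization to a seminorm. -/

section SupportFunction

variable {E : Type*} [NormedAddCommGroup E] [InnerProductSpace ℝ E] {T : Set E}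

/-- The support function `x ↦ sup_{t ∈ T} ⟨x, t⟩`. -/
noncomputable def supportFun (T : Set E) (x : E) : ℝ := ⨆ t : T, inner ℝ x (t : E)

theorem inner_le_mul_norm {R : ℝ} (hR : ∀ t ∈ T, ‖t‖ ≤ R) (x : E) (t : T) :
    inner ℝ x (t : E) ≤ R * ‖x‖ := by
  rw [mul_comm]
  exact (real_inner_le_norm x t).trans (by gcongr; exact hR t t.2)

theorem bddAbove_inner {R : ℝ} (hR : ∀ t ∈ T, ‖t‖ ≤ R) (x : E) :
    BddAbove (Set.range fun t : T => inner ℝ x (t : E)) :=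
  ⟨R * ‖x‖, by rintro _ ⟨t, rfl⟩; exact inner_le_mul_norm hR x t⟩

theorem inner_le_supportFun {R : ℝ} (hR : ∀ t ∈ T, ‖t‖ ≤ R) (x : E) {t : E} (ht : t ∈ T) :
    inner ℝ x t ≤ supportFun T x :=
  le_ciSup (bddAbove_inner hR x) (⟨t, ht⟩ : T)

theorem supportFun_le_of_forall (hT : T.Nonempty) {x : E} {b : ℝ}
    (h : ∀ t ∈ T, inner ℝ x t ≤ b) : supportFun T x ≤ b :=
  haveI := hT.to_subtype
  ciSup_le fun t : T => h t t.2

theorem supportFun_le_mul_norm {R : ℝ} (hT : T.Nonempty) (hR : ∀ t ∈ T, ‖t‖ ≤ R) (x : E) :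
    supportFun T x ≤ R * ‖x‖ :=
  supportFun_le_of_forall hT fun t ht => inner_le_mul_norm hR x ⟨t, ht⟩

theorem supportFun_add_le {R : ℝ} (hT : T.Nonempty) (hR : ∀ t ∈ T, ‖t‖ ≤ R) (x y : E) :
    supportFun T (x + y) ≤ supportFun T x + supportFun T y :=
  supportFun_le_of_forall hT fun t ht => by
    rw [inner_add_left]
    exact add_le_add (inner_le_supportFun hR x ht) (inner_le_supportFun hR y ht)

theorem supportFun_smul {c : ℝ} (hc : 0 ≤ c) (x : E) :
    supportFun T (c • x) = c * supportFun T x := by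
  simp only [supportFun, real_inner_smul_left, Real.mul_iSup_of_nonneg hc]

theorem continuous_supportFun {R : ℝ} (hT : T.Nonempty) (hR : ∀ t ∈ T, ‖t‖ ≤ R) :
    Continuous (supportFun T) := by
  have hR0 : 0 ≤ R := by
    obtain ⟨t, ht⟩ := hT
    exact (norm_nonneg t).trans (hR t ht)
  refine (LipschitzWith.of_le_add_mul ⟨R, hR0⟩ fun x y => ?_).continuous
  have h := supportFun_add_le hT hR y (x - y)
  rw [add_sub_cancel] at h
  rw [dist_eq_norm]
  exact h.trans (by gcongr; exact supportFun_le_mul_norm hT hR _)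

/-- The seminorm `x ↦ sup_{t ∈ T} ⟨x, t⟩ + sup_{t ∈ T} ⟨-x, t⟩`, the width of `T` in the
direction `x`. -/
noncomputable def widthSeminorm {R : ℝ} (hT : T.Nonempty) (hR : ∀ t ∈ T, ‖t‖ ≤ R) :
    Seminorm ℝ E :=
  Seminorm.of (fun x => supportFun T x + supportFun T (-x))
    (fun x y => by
      have h1 := supportFun_add_le hT hR x y
      have h2 := supportFun_add_le hT hR (-x) (-y)
      rw [neg_add]
      linarith)
    (fun c x => by
      rw [Real.norm_eq_abs]
      rcases le_total 0 c with hc | hc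
      · rw [abs_of_nonneg hc, ← smul_neg, supportFun_smul hc, supportFun_smul hc, mul_add]
      · have hc' : 0 ≤ -c := neg_nonneg.2 hc
        rw [abs_of_nonpos hc, ← neg_smul, supportFun_smul hc', ← neg_smul_neg,
          supportFun_smul hc', mul_add, add_comm])

theorem widthSeminorm_apply {R : ℝ} (hT : T.Nonempty) (hR : ∀ t ∈ T, ‖t‖ ≤ R) (x : E) :
    widthSeminorm hT hR x = supportFun T x + supportFun T (-x) := rfl

theorem continuous_widthSeminorm {R : ℝ} (hT : T.Nonempty) (hR : ∀ t ∈ T, ‖t‖ ≤ R) :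
    Continuous (widthSeminorm hT hR) :=
  (continuous_supportFun hT hR).add ((continuous_supportFun hT hR).comp continuous_neg)

theorem inner_sub_inner_le_widthSeminorm {R : ℝ} (hT : T.Nonempty) (hR : ∀ t ∈ T, ‖t‖ ≤ R)
    (x : E) {s t : E} (hs : s ∈ T) (ht : t ∈ T) :
    inner ℝ x s - inner ℝ x t ≤ widthSeminorm hT hR x := by
  have h1 := inner_le_supportFun hR x hs
  have h2 := inner_le_supportFun hR (-x) ht
  rw [inner_neg_left] at h2
  rw [widthSeminorm_apply]
  linarith

end SupportFunction

/-! ### Gaussian width as the mean of a seminorm. -/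

section Width

variable {n : ℕ} {T : Set (EuclideanSpace ℝ (Fin n))} {R : ℝ}

theorem gaussianWidth_eq_integral_supportFun (T : Set (EuclideanSpace ℝ (Fin n))) :
    gaussianWidth T = ∫ x, supportFun T x ∂(stdGaussian (EuclideanSpace ℝ (Fin n))) := rfl

theorem integrable_supportFun (hT : T.Nonempty) (hR : ∀ t ∈ T, ‖t‖ ≤ R) :
    Integrable (supportFun T) (stdGaussian (EuclideanSpace ℝ (Fin n))) := by
  refine (IsGaussian.integrable_id.norm.const_mul R).mono'
    (continuous_supportFun hT hR).aestronglyMeasurable (ae_of_all _ fun x => ?_)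
  obtain ⟨t, ht⟩ := hT
  rw [Real.norm_eq_abs, abs_le]
  refine ⟨?_, supportFun_le_mul_norm ⟨t, ht⟩ hR x⟩
  have h1 := inner_le_supportFun hR x ht
  have h2 := inner_le_mul_norm hR (-x) ⟨t, ht⟩
  rw [inner_neg_left, norm_neg] at h2
  simp only [id] at h2 ⊢
  linarith

theorem map_neg_stdGaussian :
    (stdGaussian (EuclideanSpace ℝ (Fin n))).map (fun x => -x)
      = stdGaussian (EuclideanSpace ℝ (Fin n)) := by
  simpa using stdGaussian_map (LinearIsometryEquiv.neg ℝ (E := EuclideanSpace ℝ (Fin n)))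

theorem integral_widthSeminorm (hT : T.Nonempty) (hR : ∀ t ∈ T, ‖t‖ ≤ R) :
    ∫ x, widthSeminorm hT hR x ∂(stdGaussian (EuclideanSpace ℝ (Fin n)))
      = 2 * gaussianWidth T := by
  have hmp : MeasurePreserving (fun x : EuclideanSpace ℝ (Fin n) => -x)
      (stdGaussian _) (stdGaussian _) := ⟨measurable_neg, map_neg_stdGaussian⟩
  have hi := integrable_supportFun hT hR
  have hneg : ∫ x, supportFun T (-x) ∂(stdGaussian (EuclideanSpace ℝ (Fin n)))
      = ∫ x, supportFun T x ∂(stdGaussian (EuclideanSpace ℝ (Fin n))) :=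
    hmp.integral_comp (MeasurableEquiv.neg _).measurableEmbedding _
  have hi_neg : Integrable (fun x => supportFun T (-x))
      (stdGaussian (EuclideanSpace ℝ (Fin n))) := hmp.integrable_comp_of_integrable hi
  simp only [widthSeminorm_apply]
  rw [integral_add hi hi_neg, hneg,
    gaussianWidth_eq_integral_supportFun, two_mul]

/-- The mean of the seminorm is `2 * gaussianWidth T`, so the constant is `2 * 2 ^ 2`. -/
theorem integral_widthSeminorm_sq_le (hT : T.Nonempty) (hR : ∀ t ∈ T, ‖t‖ ≤ R) :
    ∫ x, widthSeminorm hT hR x ^ 2 ∂(stdGaussian (EuclideanSpace ℝ (Fin n)))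
      ≤ 8 * gaussianWidth T ^ 2 := by
  have h := integral_seminorm_sq_le
    (ν := stdGaussian (EuclideanSpace ℝ (Fin n))) (by simp) (continuous_widthSeminorm hT hR)
  rw [integral_widthSeminorm] at h
  linarith

theorem gaussianWidth_nonneg (hT : T.Nonempty) (hR : ∀ t ∈ T, ‖t‖ ≤ R) :
    0 ≤ gaussianWidth T := by
  have h : 0 ≤ ∫ x, widthSeminorm hT hR x ∂(stdGaussian (EuclideanSpace ℝ (Fin n))) :=
    integral_nonneg fun x => apply_nonneg (widthSeminorm hT hR) x
  rw [integral_widthSeminorm] at h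
  linarith

theorem norm_le_of_mem_closedBall_inter {K : Set (EuclideanSpace ℝ (Fin n))}
    {μ : EuclideanSpace ℝ (Fin n)} {ε : ℝ} :
    ∀ t ∈ Metric.closedBall μ ε ∩ K, ‖t‖ ≤ ‖μ‖ + ε := fun t ht => by
  have h1 := mem_closedBall_iff_norm.1 ht.1
  have h2 := norm_le_norm_add_norm_sub' t μ
  linarith

theorem closedBall_inter_nonempty {K : Set (EuclideanSpace ℝ (Fin n))}
    {μ : EuclideanSpace ℝ (Fin n)} {ε : ℝ} (hμ : μ ∈ K) (hε : 0 ≤ ε) :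
    (Metric.closedBall μ ε ∩ K).Nonempty := ⟨μ, Metric.mem_closedBall_self hε, hμ⟩

/-- Recentering at `μ` costs only `⟨x, μ⟩`, which has mean zero. The bound is thus uniform in `μ`,
which makes the supremum over `K` finite. -/
theorem localWidth_le {K : Set (EuclideanSpace ℝ (Fin n))} {μ : EuclideanSpace ℝ (Fin n)}
    {ε : ℝ} (hμ : μ ∈ K) (hε : 0 ≤ ε) :
    localWidth K μ ε ≤ ε * ∫ x, ‖x‖ ∂(stdGaussian (EuclideanSpace ℝ (Fin n))) := by
  have hT := closedBall_inter_nonempty hμ hε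
  have hnorm : Integrable (fun x => ‖x‖) (stdGaussian (EuclideanSpace ℝ (Fin n))) :=
    IsGaussian.integrable_id.norm
  have hinner : Integrable (fun x => inner ℝ x μ) (stdGaussian (EuclideanSpace ℝ (Fin n))) :=
    IsGaussian.integrable_id.inner_const μ
  have hzero : ∫ x, inner ℝ x μ ∂(stdGaussian (EuclideanSpace ℝ (Fin n))) = 0 := by
    simpa [real_inner_comm] using integral_strongDual_stdGaussian (innerSL ℝ μ)
  rw [localWidth, gaussianWidth_eq_integral_supportFun]
  calc ∫ x, supportFun (Metric.closedBall μ ε ∩ K) x ∂(stdGaussian (EuclideanSpace ℝ (Fin n)))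
      ≤ ∫ x, (ε * ‖x‖ + inner ℝ x μ) ∂(stdGaussian (EuclideanSpace ℝ (Fin n))) := by
        refine integral_mono (integrable_supportFun hT norm_le_of_mem_closedBall_inter)
          ((hnorm.const_mul ε).add hinner) fun x => supportFun_le_of_forall hT fun t ht => ?_
        have h1 := real_inner_le_norm x (t - μ)
        have h2 : ‖x‖ * ‖t - μ‖ ≤ ‖x‖ * ε := by
          gcongr
          exact mem_closedBall_iff_norm.1 ht.1
        rw [inner_sub_right] at h1
        linarith
    _ = ε * ∫ x, ‖x‖ ∂(stdGaussian (EuclideanSpace ℝ (Fin n))) := by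
        rw [integral_add (hnorm.const_mul ε) hinner, integral_const_mul, hzero, add_zero]

end Width

/-! ### Risk bounds for the least squares estimator. -/

section Risk

variable {n : ℕ} {K : Set (EuclideanSpace ℝ (Fin n))} {σ : ℝ}

theorem localWidth_le_iSup {μ : EuclideanSpace ℝ (Fin n)} {ε : ℝ} (hμ : μ ∈ K) (hε : 0 ≤ ε) :
    localWidth K μ ε ≤ ⨆ μ : K, localWidth K (μ : EuclideanSpace ℝ (Fin n)) ε :=
  le_ciSup (f := fun μ : K => localWidth K (μ : EuclideanSpace ℝ (Fin n)) ε)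
    ⟨_, by rintro _ ⟨ν, rfl⟩; exact localWidth_le ν.2 hε⟩ ⟨μ, hμ⟩

/-- The width grows at most linearly in `ε` and the left side quadratically. Without boundedness the
real `sSup` would take the default value `0`. -/
theorem bddAbove_epsBar_set (hne : K.Nonempty) (hσ : 0 < σ) :
    BddAbove {ε : ℝ | 0 ≤ ε ∧
      ε ^ 2 / (2 * σ) ≤ ⨆ μ : K, localWidth K (μ : EuclideanSpace ℝ (Fin n)) ε} := by
  have := hne.to_subtype
  set M := ∫ x, ‖x‖ ∂(stdGaussian (EuclideanSpace ℝ (Fin n))) with hM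
  have hM0 : 0 ≤ M := integral_nonneg fun x => norm_nonneg x
  refine ⟨2 * σ * M, fun ε hε => ?_⟩
  obtain ⟨h0, h1⟩ := hε
  have h2 : ε ^ 2 / (2 * σ) ≤ ε * M := h1.trans (ciSup_le fun μ => localWidth_le μ.2 h0)
  rw [div_le_iff₀ (by positivity)] at h2
  rcases h0.eq_or_lt with h | h
  · rw [← h]; positivity
  · refine le_of_mul_le_mul_left ?_ h
    linarith

theorem epsBar_nonneg : 0 ≤ epsBar K σ := Real.sSup_nonneg fun _ h => h.1

theorem localWidth_lt_of_epsBar_lt (hne : K.Nonempty) (hσ : 0 < σ)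
    {μ : EuclideanSpace ℝ (Fin n)} (hμ : μ ∈ K) {ε : ℝ} (hε : epsBar K σ < ε) :
    localWidth K μ ε < ε ^ 2 / (2 * σ) := by
  have h0 : 0 ≤ ε := epsBar_nonneg.trans hε.le
  refine (localWidth_le_iSup hμ h0).trans_lt (not_le.1 fun h => ?_)
  exact hε.not_ge (le_csSup (bddAbove_epsBar_set hne hσ) ⟨h0, h⟩)

/-- The basic inequality for the least squares estimator over a convex set. -/
theorem IsLeastSquares.norm_sub_sq_le (hK : Convex ℝ K) {y p μ : EuclideanSpace ℝ (Fin n)}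
    (hp : IsLeastSquares K y p) (hμ : μ ∈ K) : ‖p - μ‖ ^ 2 ≤ inner ℝ (y - μ) (p - μ) := by
  have : Nonempty K := ⟨⟨μ, hμ⟩⟩
  have hmin : ‖y - p‖ = ⨅ w : K, ‖y - w‖ := by
    refine le_antisymm (le_ciInf fun w => ?_)
      (ciInf_le (f := fun w : K => ‖y - w‖) ⟨0, ?_⟩ ⟨p, hp.1⟩)
    · exact le_of_sq_le_sq (hp.2 w w.2) (norm_nonneg _)
    · rintro _ ⟨w, rfl⟩
      exact norm_nonneg _
  have h := (norm_eq_iInf_iff_real_inner_le_zero hK hp.1).1 hmin μ hμ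
  have e : inner ℝ (y - p) (μ - p) = ‖p - μ‖ ^ 2 - inner ℝ (y - μ) (p - μ) := by
    rw [show y - p = (y - μ) - (p - μ) by abel, show μ - p = -(p - μ) by abel, inner_neg_right,
      inner_sub_left, real_inner_self_eq_norm_sq]
    ring
  linarith

theorem norm_lse_sub_sq_le (hcl : IsClosed K) (hK : Convex ℝ K) (hne : K.Nonempty) (hσ : 0 < σ)
    {μ : EuclideanSpace ℝ (Fin n)} (hμ : μ ∈ K) {ε : ℝ} (hε : 0 < ε)
    (x : EuclideanSpace ℝ (Fin n)) :
    ‖lse K (μ + σ • x) - μ‖ ^ 2 ≤ ε ^ 2 + (σ / ε) ^ 2 *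
      widthSeminorm (closedBall_inter_nonempty hμ hε.le) norm_le_of_mem_closedBall_inter x ^ 2 := by
  have hp := isLeastSquares_lse hcl hne (μ + σ • x)
  have hb := hp.norm_sub_sq_le hK hμ
  set p := lse K (μ + σ • x)
  set r := ‖p - μ‖ with hr
  set g := widthSeminorm (closedBall_inter_nonempty hμ hε.le) norm_le_of_mem_closedBall_inter x
    with hg
  rw [add_sub_cancel_left, real_inner_smul_left] at hb
  rcases le_or_gt r ε with h | h
  · have : r ^ 2 ≤ ε ^ 2 := by gcongr
    have h2 : 0 ≤ (σ / ε) ^ 2 * g ^ 2 := by positivity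
    linarith
  · have hr0 : 0 < r := hε.trans h
    -- The point of the segment from `μ` to `p` at distance `ε` from `μ`.
    have hq : μ + (ε / r) • (p - μ) ∈ Metric.closedBall μ ε ∩ K := by
      refine ⟨?_, hK.add_smul_sub_mem hμ hp.1 ⟨by positivity, (div_le_one hr0).2 h.le⟩⟩
      rw [mem_closedBall_iff_norm, add_sub_cancel_left, norm_smul, Real.norm_eq_abs,
        abs_of_pos (by positivity), ← hr, div_mul_cancel₀ _ hr0.ne']
    have h1 := inner_sub_inner_le_widthSeminorm (closedBall_inter_nonempty hμ hε.le)
      norm_le_of_mem_closedBall_inter x hq ⟨Metric.mem_closedBall_self hε.le, hμ⟩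
    rw [inner_add_right, add_sub_cancel_left, real_inner_smul_right, ← hg] at h1
    have h2 : r ≤ σ / ε * g := by
      calc r = r ^ 2 / r := by field_simp
        _ ≤ σ * inner ℝ x (p - μ) / r := by gcongr
        _ = σ / ε * (ε / r * inner ℝ x (p - μ)) := by field_simp
        _ ≤ σ / ε * g := by gcongr
    have h3 : r ^ 2 ≤ (σ / ε * g) ^ 2 := by gcongr
    rw [mul_pow] at h3
    linarith [sq_nonneg ε]

theorem lseRisk_le_of_epsBar_lt (hcl : IsClosed K) (hK : Convex ℝ K) (hne : K.Nonempty)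
    (hσ : 0 < σ) {μ : EuclideanSpace ℝ (Fin n)} (hμ : μ ∈ K) {ε : ℝ} (hε : epsBar K σ < ε) :
    lseRisk K σ μ ≤ ENNReal.ofReal (2 * ε) ^ 2 := by
  have hε0 : 0 < ε := epsBar_nonneg.trans_lt hε
  have hT := closedBall_inter_nonempty hμ hε0.le
  have hR := norm_le_of_mem_closedBall_inter (K := K) (μ := μ) (ε := ε)
  have hi : Integrable (fun x => widthSeminorm hT hR x ^ 2)
      (stdGaussian (EuclideanSpace ℝ (Fin n))) :=
    (memLp_two_seminorm (continuous_widthSeminorm hT hR)).integrable_sq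
  have hi' : Integrable (fun x => ε ^ 2 + (σ / ε) ^ 2 * widthSeminorm hT hR x ^ 2)
      (stdGaussian (EuclideanSpace ℝ (Fin n))) := (integrable_const _).add (hi.const_mul _)
  have hw : gaussianWidth (Metric.closedBall μ ε ∩ K) ^ 2 ≤ (ε ^ 2 / (2 * σ)) ^ 2 := by
    have h0 := gaussianWidth_nonneg hT hR
    have h1 : gaussianWidth (Metric.closedBall μ ε ∩ K) ≤ ε ^ 2 / (2 * σ) :=
      (localWidth_lt_of_epsBar_lt hne hσ hμ hε).le
    gcongr
  calc lseRisk K σ μ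
      ≤ ∫⁻ x, ENNReal.ofReal (ε ^ 2 + (σ / ε) ^ 2 * widthSeminorm hT hR x ^ 2)
          ∂(stdGaussian (EuclideanSpace ℝ (Fin n))) :=
        lintegral_mono fun x =>
          ENNReal.ofReal_le_ofReal (norm_lse_sub_sq_le hcl hK hne hσ hμ hε0 x)
    _ = ENNReal.ofReal (∫ x, (ε ^ 2 + (σ / ε) ^ 2 * widthSeminorm hT hR x ^ 2)
          ∂(stdGaussian (EuclideanSpace ℝ (Fin n)))) :=
        (ofReal_integral_eq_lintegral_ofReal hi' (ae_of_all _ fun x => by positivity)).symm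
    _ ≤ ENNReal.ofReal ((2 * ε) ^ 2) := by
        refine ENNReal.ofReal_le_ofReal ?_
        rw [integral_add (integrable_const _) (hi.const_mul _), integral_const_mul,
          integral_const, probReal_univ, one_smul]
        calc ε ^ 2 + (σ / ε) ^ 2 * ∫ x, widthSeminorm hT hR x ^ 2
                ∂(stdGaussian (EuclideanSpace ℝ (Fin n)))
            ≤ ε ^ 2 + (σ / ε) ^ 2 * (8 * (ε ^ 2 / (2 * σ)) ^ 2) := by
              gcongr
              exact (integral_widthSeminorm_sq_le hT hR).trans (by gcongr)
          -- The second term equals `2 * ε ^ 2`: the noise level cancels.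
          _ = 3 * ε ^ 2 := by field_simp; ring
          _ ≤ (2 * ε) ^ 2 := by nlinarith [sq_nonneg ε]
    _ = ENNReal.ofReal (2 * ε) ^ 2 := ENNReal.ofReal_pow (by positivity) 2

theorem lseRisk_le_ediam_sq (hcl : IsClosed K) {μ : EuclideanSpace ℝ (Fin n)} (hμ : μ ∈ K) :
    lseRisk K σ μ ≤ Metric.ediam K ^ 2 := by
  calc lseRisk K σ μ
      ≤ ∫⁻ _, Metric.ediam K ^ 2 ∂(stdGaussian (EuclideanSpace ℝ (Fin n))) := by
        refine lintegral_mono fun x => ?_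
        rw [ENNReal.ofReal_pow (norm_nonneg _), ← dist_eq_norm, ← edist_dist]
        gcongr
        exact Metric.edist_le_ediam_of_mem (isLeastSquares_lse hcl ⟨μ, hμ⟩ _).1 hμ
    _ = Metric.ediam K ^ 2 := by simp

theorem worstCaseRate_le_of_forall {b : ℝ≥0∞} (h : ∀ μ ∈ K, lseRisk K σ μ ≤ b ^ 2) :
    worstCaseRate K σ ≤ b := by
  calc worstCaseRate K σ ≤ (b ^ 2) ^ (1 / 2 : ℝ) := by
        unfold worstCaseRate
        gcongr
        exact iSup₂_le h
    _ = b := by rw [← ENNReal.rpow_natCast, ← ENNReal.rpow_mul]; norm_num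

/-- The risk bound is available only for `ε` strictly above `epsBar K σ`, which also keeps `ε`
positive; a right limit reaches the endpoint, even when it is `0`. -/
theorem worstCaseRate_le_epsBar (hcl : IsClosed K) (hK : Convex ℝ K) (hne : K.Nonempty)
    (hσ : 0 < σ) : worstCaseRate K σ ≤ ENNReal.ofReal (2 * epsBar K σ) := by
  have hcont : Continuous fun ε : ℝ => ENNReal.ofReal (2 * ε) :=
    ENNReal.continuous_ofReal.comp (continuous_const_mul 2)
  refine ge_of_tendsto (hcont.continuousWithinAt (s := Set.Ioi (epsBar K σ))) ?_
  filter_upwards [self_mem_nhdsWithin] with ε hε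
  exact worstCaseRate_le_of_forall fun μ hμ => lseRisk_le_of_epsBar_lt hcl hK hne hσ hμ hε

end Risk

end GaussianSeq

theorem proposition2p5 :
    ∃ C : ℝ≥0, 0 < C ∧
      ∀ (n : ℕ) (K : Set (EuclideanSpace ℝ (Fin n))) (σ : ℝ),
        IsClosed K → Convex ℝ K → K.Nonempty → 0 < σ →
          GaussianSeq.worstCaseRate K σ ≤
            (C : ℝ≥0∞) * min (ENNReal.ofReal (GaussianSeq.epsBar K σ)) (Metric.ediam K) := by
  refine ⟨2, by norm_num, fun n K σ hcl hK hne hσ => ?_⟩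
  rcases min_choice (ENNReal.ofReal (GaussianSeq.epsBar K σ)) (Metric.ediam K) with h | h <;>
    rw [h]
  · have := GaussianSeq.worstCaseRate_le_epsBar hcl hK hne hσ
    rwa [ENNReal.ofReal_mul (by norm_num), ENNReal.ofReal_ofNat] at this
  · refine (GaussianSeq.worstCaseRate_le_of_forall fun μ hμ =>
      GaussianSeq.lseRisk_le_ediam_sq hcl hμ).trans ?_
    exact le_mul_of_one_le_left' (by norm_num)
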